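/- Let the sites of $\mathbb Z^2$ be independently open (value $1$) with probability $p$ and closed (value $0$) with probability $1-p$, and let $\omega_0=\omega$ be the resulting configuration. The bootstrap dynamics updates it at times $n=1,2,3,\dots$: open sites stay open, and a closed site becomes open at the next update exactly when at least three of its four nearest neighbors are open. Let $\omega_n$ be the configuration after $n$ updates and $\omega_\infty=\bar\omega$ the final (pointwise limiting) configuration. Let $\mathbb Z^2_{cp}$ be the lattice obtained from $\mathbb Z^2$ by adding both diagonals of every face; a $*$-path is a self-avoiding path in $\mathbb Z^2_{cp}$. Let $p_c^*$ be the critical value of independent site percolation on $\mathbb Z^2_{cp}$, and take $p=p_c^*$. For $b,h>0$ let $\mathcal R(b,h)=(-b/2,b/2)\times(-h/2,h/2)$. For $\delta>0$ and $n\in\{0,1,2,\dots\}\cup\{\infty\}$ let $\phi^*_\delta(b,h;n)$ be the probability that there is an open vertical $*$-crossing of $\mathcal R(b,h)$ at time $n$, that is, a $*$-path $(x_0,x_1,\dots,x_m,x_{m+1})$, $m\ge 1$, with $\omega_n(x_j)=1$ for all $0\le j\le m+1$, with $\delta x_1,\dots,\delta x_m\in\mathcal R(b,h)$, and such that the line segments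 $\overline{\delta x_0,\delta x_1}$ and $\overline{\delta x_m,\delta x_{m+1}}$ touch the top side $[-b/2,b/2]\times\{h/2\}$ and the bottom side $[-b/2,b/2]\times\{-h/2\}$, respectively. **Theorem.** Suppose that there is a continuous function $F:(0,\infty)\to\mathbb R$ such that for all $b,h>0$ $$\lim_{\delta\downarrow0}\phi^*_\delta(b,h;0)=F(b/h).$$ Then for all $b,h>0$ the final configuration has the same scaling limit, $$\lim_{\delta\downarrow0}\phi^*_\delta(b,h;\infty)=F(b/h),$$ and likewise $\lim_{\delta\downarrow0}\phi^*_\delta(b,h;n)=F(b/h)$ for every $n\in\{1,2,3,\dots\}$. -/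

import Mathlib

open MeasureTheory ProbabilityTheory Filter Topology

/-- A configuration on `ℤ²`; the value `true` means `1` (open), `false` means `0` (closed). -/
abbrev Config : Type := ℤ × ℤ → Bool

/-- The four nearest neighbours of a site in `ℤ²`. -/
def nearestNbrs (x : ℤ × ℤ) : Finset (ℤ × ℤ) :=
  {(x.1 + 1, x.2), (x.1 - 1, x.2), (x.1, x.2 + 1), (x.1, x.2 - 1)}

/-- One update of the bootstrap dynamics: a `1` stays a `1`, and a `0` becomes a `1` exactly when
at least three of its four nearest neighbours are `1`. -/
def bootstrapStep (ω : Config) : Config := fun x =>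
  ω x || decide (3 ≤ ((nearestNbrs x).filter (fun y => ω y = true)).card)

/-- The final configuration: a site is `1` if and only if it is `1` after finitely many updates. -/
noncomputable def bootstrapFinal (ω : Config) : Config := fun x =>
  open Classical in decide (∃ k : ℕ, bootstrapStep^[k] ω x = true)

/-- The configuration at time `n ∈ {0, 1, 2, …} ∪ {∞}` started from `ω`. -/
noncomputable def configAt (ω : Config) : ℕ∞ → Config
  | ⊤ => bootstrapFinal ω
  | (n : ℕ) => bootstrapStep^[n] ω

theorem bootstrapStep_of_open {ω : Config} {x : ℤ × ℤ} (h : ω x = true) :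
    bootstrapStep ω x = true := by
  simp [bootstrapStep, h]

/-- The final configuration is the pointwise limit of the configurations at finite times. -/
theorem tendsto_configAt (ω : Config) (x : ℤ × ℤ) :
    ∀ᶠ n : ℕ in atTop, configAt ω n x = configAt ω ⊤ x := by
  have key : ∀ k m : ℕ, bootstrapStep^[k] ω x = true → bootstrapStep^[k + m] ω x = true := by
    intro k m h
    induction m with
    | zero => exact h
    | succ m ih =>
      rw [← add_assoc, Function.iterate_succ_apply']
      exact bootstrapStep_of_open ih
  change ∀ᶠ n : ℕ in atTop, bootstrapStep^[n] ω x = bootstrapFinal ω x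
  by_cases hx : ∃ k : ℕ, bootstrapStep^[k] ω x = true
  · obtain ⟨k, hk⟩ := hx
    filter_upwards [eventually_ge_atTop k] with n hn
    obtain ⟨m, rfl⟩ := Nat.exists_eq_add_of_le hn
    have hex : ∃ k : ℕ, bootstrapStep^[k] ω x = true := ⟨k, hk⟩
    simp [key k m hk, bootstrapFinal, hex]
  · filter_upwards with n
    have hn : bootstrapStep^[n] ω x ≠ true := fun h => hx ⟨n, h⟩
    simp only [bootstrapFinal, hx, decide_false]
    simpa using hn

/-- The close-packed square lattice `ℤ²_cp`: the square lattice with both diagonals of every face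
added, so that every site has eight neighbours. -/
def closePacked : SimpleGraph (ℤ × ℤ) where
  Adj x y := x ≠ y ∧ |x.1 - y.1| ≤ 1 ∧ |x.2 - y.2| ≤ 1
  symm := ⟨fun x y h =>
    ⟨h.1.symm, by rw [abs_sub_comm]; exact h.2.1, by rw [abs_sub_comm]; exact h.2.2⟩⟩
  loopless := ⟨fun _ h => h.1 rfl⟩

/-- `(x 0, …, x k)` is a `*`-path (a self-avoiding path in `ℤ²_cp`) of sites which are open
in `ω`. Values `x j` with `j > k` are irrelevant. -/
def IsOpenStarPath (ω : Config) (k : ℕ) (x : ℕ → ℤ × ℤ) : Prop :=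
  (∀ j < k, closePacked.Adj (x j) (x (j + 1))) ∧ Set.InjOn x (Set.Iic k) ∧
    ∀ j ≤ k, ω (x j) = true

/-- The open `*`-cluster of the origin. -/
def openStarCluster (ω : Config) : Set (ℤ × ℤ) :=
  {y | ∃ (k : ℕ) (x : ℕ → ℤ × ℤ), IsOpenStarPath ω k x ∧ x 0 = (0, 0) ∧ x k = y}

/-- The product measure under which the sites are independently open with probability `p`
and closed with probability `1 - p`. -/
noncomputable def productBernoulli (p : unitInterval) : Measure Config :=
  Measure.infinitePi (fun _ : ℤ × ℤ => bernoulliMeasure true false p)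

instance (p : unitInterval) : IsProbabilityMeasure (productBernoulli p) := by
  unfold productBernoulli
  infer_instance

/-- The critical value of independent site percolation on `ℤ²_cp`. -/
noncomputable def criticalStar : unitInterval :=
  sInf {p : unitInterval | 0 < productBernoulli p {ω | (openStarCluster ω).Infinite}}

/-- The position in the plane of the site `x` of the lattice with mesh `δ`. -/
def scaled (δ : ℝ) (x : ℤ × ℤ) : ℝ × ℝ := (δ * x.1, δ * x.2)

/-- The open rectangle with sides `b` (horizontal) and `h` (vertical), centred at the origin. -/
def rectangle (b h : ℝ) : Set (ℝ × ℝ) := Set.Ioo (-b / 2) (b / 2) ×ˢ Set.Ioo (-h / 2) (h / 2)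

/-- The top side of the rectangle. -/
def topSide (b h : ℝ) : Set (ℝ × ℝ) := Set.Icc (-b / 2) (b / 2) ×ˢ {h / 2}

/-- The bottom side of the rectangle. -/
def bottomSide (b h : ℝ) : Set (ℝ × ℝ) := Set.Icc (-b / 2) (b / 2) ×ˢ {-h / 2}

/-- There is an open vertical `*`-crossing of the rectangle at mesh `δ`: an open `*`-path
`(x 0, x 1, …, x m, x (m + 1))` with `m ≥ 1` whose interior sites `x 1, …, x m` lie (after scaling)
in the rectangle, and whose first and last steps touch the top and the bottom side. -/
def HasVerticalCrossing (δ b h : ℝ) (ω : Config) : Prop :=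
  ∃ (m : ℕ) (x : ℕ → ℤ × ℤ), 1 ≤ m ∧ IsOpenStarPath ω (m + 1) x ∧
    (∀ j, 1 ≤ j → j ≤ m → scaled δ (x j) ∈ rectangle b h) ∧
    (segment ℝ (scaled δ (x 0)) (scaled δ (x 1)) ∩ topSide b h).Nonempty ∧
    (segment ℝ (scaled δ (x m)) (scaled δ (x (m + 1))) ∩ bottomSide b h).Nonempty

/-- The probability of an open vertical `*`-crossing of the rectangle with sides `b`, `h` at
mesh `δ` in the configuration at time `n`, when the initial density of open sites is `p`. -/
noncomputable def crossingProb (p : unitInterval) (δ b h : ℝ) (n : ℕ∞) : ℝ :=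
  (productBernoulli p).real {ω | HasVerticalCrossing δ b h (configAt ω n)}

/-!
The bootstrap dynamics only opens sites, so the crossing probabilities increase with time, and it
suffices to bound the crossing probability of the final configuration from above by the initial
crossing probability of a slightly wider and lower rectangle, up to a term that vanishes with the
mesh. Continuity of `F` then removes the difference between the two rectangles. The argument works
for every density `p`, with the trivial exception of `p = 1`, where all sites are open from the
start.

If the wider rectangle has no open vertical `*`-crossing initially, then it has a closed horizontal
crossing in `ℤ²` (`exists_closed_crossing_or_open_star_crossing`). A site of a closed path which is
not an end of the path has two closed neighbours, hence is never opened while its neighbours are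
closed; so a path survives as soon as both its ends belong to `2 × 2` blocks of closed sites
(`reachable_closed_bootstrapFinal`). A surviving path across the original rectangle excludes an open
vertical `*`-crossing in the final configuration (`exists_mem_of_closed_crossing`).

The blocks are found in the two strips by which the wider rectangle exceeds the original one. The
closed cluster of the left side is explored column by column. Whenever it reaches a column of the
right strip, the next two columns are still unexplored, and with probability `(1 - p) ^ 4` four of
their sites form a closed block attached to the cluster. The number of independent attempts is of
the order of `1 / δ` (`productBernoulli_real_forall_trials_le`). The same exploration is then run
leftwards, starting from the blocks found in the right strip, so that the block which it finds in
the left strip is joined to a block in the right strip by one and the same closed path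
(`exists_bad_set`).
-/

/-! ### Independent attempts -/

theorem productBernoulli_real_forall_closed (p : unitInterval) (t : Finset (ℤ × ℤ)) :
    (productBernoulli p).real {ω | ∀ v ∈ t, ω v = false} = (1 - (p : ℝ)) ^ t.card := by
  have hset : {ω : Config | ∀ v ∈ t, ω v = false} = (t : Set (ℤ × ℤ)).pi fun _ => {false} := by
    ext ω
    simp [Set.mem_pi]
  rw [hset, measureReal_def, productBernoulli, Measure.infinitePi_pi _ (by simp),
    ENNReal.toReal_prod]
  simp

theorem measurableSet_of_dependsOn {S : Finset (ℤ × ℤ)} {E : Config → Prop}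
    (hE : DependsOn E S) : MeasurableSet {ω | E ω} := by
  obtain ⟨g, hg⟩ := dependsOn_iff_exists_comp.1 hE
  have : {ω | E ω} = (fun (ω : Config) (v : (S : Set (ℤ × ℤ))) => ω v) ⁻¹' {z | g z} := by
    ext ω
    simp [hg]; rfl
  rw [this]
  exact measurableSet_preimage (by fun_prop) (Set.toFinite _).measurableSet

theorem productBernoulli_real_inter_of_disjoint (p : unitInterval) {S t : Finset (ℤ × ℤ)}
    (hSt : Disjoint S t) {E E' : Config → Prop} (hE : DependsOn E S) (hE' : DependsOn E' t) :
    (productBernoulli p).real {ω | E ω ∧ E' ω} =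
      (productBernoulli p).real {ω | E ω} * (productBernoulli p).real {ω | E' ω} := by
  obtain ⟨g, hg⟩ := dependsOn_iff_exists_comp.1 hE
  obtain ⟨g', hg'⟩ := dependsOn_iff_exists_comp.1 hE'
  have hind := (iIndepFun_infinitePi (P := fun _ : ℤ × ℤ => bernoulliMeasure true false p)
    (X := fun _ b => b) (fun _ => measurable_id)).indepFun_finset S t hSt (by fun_prop)
  have h := hind.measure_inter_preimage_eq_mul {z | g z} {z | g' z}
    (Set.toFinite _).measurableSet (Set.toFinite _).measurableSet
  subst hg hg'
  simp only [measureReal_def, ← ENNReal.toReal_mul]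
  exact congrArg ENNReal.toReal h

/-- The `i`-th attempt succeeds if the sites of `T i ω`, at most `d` in number, are all closed. If
these sites are chosen depending on the configuration in `S i` only, but lie outside `S i`, then
each attempt succeeds with conditional probability at least `(1 - p) ^ d` given the past. -/
theorem productBernoulli_real_forall_trials_le (p : unitInterval) (S : ℕ → Finset (ℤ × ℤ))
    (T : ℕ → Config → Finset (ℤ × ℤ)) (hS : Monotone S) (hdep : ∀ i, DependsOn (T i) (S i))
    (hsub : ∀ i ω, T i ω ⊆ S (i + 1)) (hdisj : ∀ i ω, Disjoint (S i) (T i ω)) (d : ℕ)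
    (hcard : ∀ i ω, (T i ω).card ≤ d) (k : ℕ) :
    (productBernoulli p).real {ω | ∀ i < k, ∃ v ∈ T i ω, ω v = true} ≤
      (1 - (1 - (p : ℝ)) ^ d) ^ k := by
  have hp0 : 0 ≤ 1 - (p : ℝ) := sub_nonneg.2 p.2.2
  have hp1 : 1 - (p : ℝ) ≤ 1 := sub_le_self _ p.2.1
  induction k with
  | zero => simp
  | succ k ih =>
    set E : Config → Prop := fun ω => ∀ i < k, ∃ v ∈ T i ω, ω v = true with hEdef
    have hE : DependsOn E (S k) := by
      intro ω ω' h
      have hi : ∀ i < k, (∃ v ∈ T i ω, ω v = true) = (∃ v ∈ T i ω', ω' v = true) := by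
        intro i hi
        rw [← hdep i fun v hv => h v (hS hi.le hv)]
        refine propext (exists_congr fun v => and_congr_right fun hv => ?_)
        rw [h v (hS (Nat.succ_le_of_lt hi) (hsub i ω hv))]
      exact propext (forall₂_congr fun i hik => by rw [hi i hik])
    have hET : ∀ t, DependsOn (fun ω => E ω ∧ T k ω = t) (S k) := fun t ω ω' h => by
      simp only [hE h, hdep k h]
    have hopen : ∀ t : Finset (ℤ × ℤ), DependsOn (fun ω : Config => ∃ v ∈ t, ω v = true) t :=
      fun t ω ω' h => propext (exists_congr fun v => and_congr_right fun hv => by rw [h v hv])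
    -- Given the value `t` of `T k`, the sites of `t` are independent of the first `k` attempts.
    have hterm : ∀ t ∈ (S (k + 1)).powerset,
        (productBernoulli p).real {ω | (E ω ∧ T k ω = t) ∧ ∃ v ∈ t, ω v = true} ≤
          (1 - (1 - (p : ℝ)) ^ d) * (productBernoulli p).real {ω | E ω ∧ T k ω = t} := by
      intro t _
      by_cases ht : ∃ ω, T k ω = t
      · obtain ⟨ω₀, rfl⟩ := ht
        rw [productBernoulli_real_inter_of_disjoint p (hdisj k ω₀) (hET _) (hopen _), mul_comm]
        gcongr
        have hc : {ω : Config | ∃ v ∈ T k ω₀, ω v = true} =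
            {ω | ∀ v ∈ T k ω₀, ω v = false}ᶜ := by
          ext ω
          simp
        rw [hc, probReal_compl_eq_one_sub (measurableSet_of_dependsOn
          (S := T k ω₀) fun ω ω' h => propext (forall₂_congr fun v hv => by rw [h v hv])),
          productBernoulli_real_forall_closed]
        exact sub_le_sub_left (pow_le_pow_of_le_one hp0 hp1 (hcard k ω₀)) 1
      · have hempty : ∀ ω, ¬ T k ω = t := fun ω h => ht ⟨ω, h⟩
        simp [hempty]
    calc (productBernoulli p).real {ω | ∀ i < k + 1, ∃ v ∈ T i ω, ω v = true}
        ≤ (productBernoulli p).real (⋃ t ∈ (S (k + 1)).powerset,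
            {ω | (E ω ∧ T k ω = t) ∧ ∃ v ∈ t, ω v = true}) := by
          refine measureReal_mono (fun ω hω => ?_) (measure_ne_top _ _)
          simp only [Set.mem_iUnion]
          exact ⟨T k ω, Finset.mem_powerset.2 (hsub k ω),
            ⟨fun i hi => hω i (hi.trans k.lt_succ_self), rfl⟩, hω k k.lt_succ_self⟩
      _ ≤ ∑ t ∈ (S (k + 1)).powerset,
            (productBernoulli p).real {ω | (E ω ∧ T k ω = t) ∧ ∃ v ∈ t, ω v = true} :=
          measureReal_biUnion_finset_le _ _
      _ ≤ ∑ t ∈ (S (k + 1)).powerset,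
            (1 - (1 - (p : ℝ)) ^ d) * (productBernoulli p).real {ω | E ω ∧ T k ω = t} :=
          Finset.sum_le_sum hterm
      _ = (1 - (1 - (p : ℝ)) ^ d) * (productBernoulli p).real
            (⋃ t ∈ (S (k + 1)).powerset, {ω | E ω ∧ T k ω = t}) := by
          rw [← Finset.mul_sum, measureReal_biUnion_finset]
          · intro t _ t' _ htt'
            exact Set.disjoint_left.2 fun ω h h' => htt' (h.2.symm.trans h'.2)
          · exact fun t _ => measurableSet_of_dependsOn (hET t)
      _ ≤ (1 - (1 - (p : ℝ)) ^ d) * (1 - (1 - (p : ℝ)) ^ d) ^ k := by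
          gcongr
          · exact sub_nonneg.2 (pow_le_one₀ hp0 hp1)
          · refine (measureReal_mono fun ω hω => ?_).trans ih
            simp only [Set.mem_iUnion] at hω
            obtain ⟨t, _, h, _⟩ := hω
            exact h
      _ = (1 - (1 - (p : ℝ)) ^ d) ^ (k + 1) := (pow_succ' _ _).symm

/-! ### Duality of crossings in the square lattice and the close-packed lattice -/

/-- The square lattice `ℤ²`. -/
def squareLattice : SimpleGraph (ℤ × ℤ) where
  Adj x y := y ∈ nearestNbrs x
  symm := ⟨fun x y h => by
    simp only [nearestNbrs, Finset.mem_insert, Finset.mem_singleton, Prod.ext_iff] at h ⊢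
    omega⟩
  loopless := ⟨fun x h => by
    simp only [nearestNbrs, Finset.mem_insert, Finset.mem_singleton, Prod.ext_iff] at h
    omega⟩

theorem squareLattice_adj {x y : ℤ × ℤ} : squareLattice.Adj x y ↔
    y = (x.1 + 1, x.2) ∨ y = (x.1 - 1, x.2) ∨ y = (x.1, x.2 + 1) ∨ y = (x.1, x.2 - 1) := by
  simp [squareLattice, nearestNbrs]

/-- The graph `G` with all edges removed that are not inside `s`; the vertices outside `s` become
isolated. -/
def edgesWithin {V : Type*} (G : SimpleGraph V) (s : Set V) : SimpleGraph V where
  Adj x y := G.Adj x y ∧ x ∈ s ∧ y ∈ s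
  symm := ⟨fun _ _ h => ⟨h.1.symm, h.2.2, h.2.1⟩⟩
  loopless := ⟨fun _ h => h.1.ne rfl⟩

theorem edgesWithin_mono {V : Type*} (G : SimpleGraph V) {s t : Set V} (h : s ⊆ t) :
    edgesWithin G s ≤ edgesWithin G t :=
  fun _ _ hxy => ⟨hxy.1, h hxy.2.1, h hxy.2.2⟩

theorem reachable_mem_of_forall_adj {V : Type*} {G : SimpleGraph V} {R : Set V} {a b : V}
    (hab : G.Reachable a b) (ha : a ∈ R) (hR : ∀ x y, G.Adj x y → x ∈ R → y ∈ R) : b ∈ R := by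
  obtain ⟨w⟩ := hab
  induction w with
  | nil => exact ha
  | cons h _ ih => exact ih (hR _ _ h ha)

theorem mem_of_reachable_edgesWithin {V : Type*} {G : SimpleGraph V} {s : Set V} {a b : V}
    (hab : (edgesWithin G s).Reachable a b) (ha : a ∈ s) : b ∈ s :=
  reachable_mem_of_forall_adj hab ha fun _ _ h _ => h.2.2

theorem sum_range_add_succ_zmod_two (f : ℕ → ZMod 2) (n : ℕ) :
    ∑ i ∈ Finset.range n, (f i + f (i + 1)) = f 0 + f n := by
  have h := Finset.sum_range_sub f n
  simp only [CharTwo.sub_eq_add] at h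
  rw [add_comm (f 0), ← h]
  exact Finset.sum_congr rfl fun i _ => add_comm _ _

/-- Indicator of the edges with labels `0` and `1` at their ends. -/
def zeroOneEdge (p q : Fin 3) : ZMod 2 := if (p = 0 ∧ q = 1) ∨ (p = 1 ∧ q = 0) then 1 else 0

/-- If no corner with label `2` of a face has both a neighbour with label `0` and another corner
with label `1`, then an even number of sides of the face have labels `0` and `1`: as soon as there
is such a side, no label `2` is next to a label `0`, and all labels `2` can be replaced by `1`. -/
theorem zeroOneEdge_face : ∀ l₀ l₁ l₂ l₃ : Fin 3,
    (l₀ = 2 → l₁ = 0 ∨ l₂ = 0 → l₁ ≠ 1 ∧ l₂ ≠ 1 ∧ l₃ ≠ 1) →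
    (l₁ = 2 → l₀ = 0 ∨ l₃ = 0 → l₀ ≠ 1 ∧ l₂ ≠ 1 ∧ l₃ ≠ 1) →
    (l₂ = 2 → l₀ = 0 ∨ l₃ = 0 → l₀ ≠ 1 ∧ l₁ ≠ 1 ∧ l₃ ≠ 1) →
    (l₃ = 2 → l₁ = 0 ∨ l₂ = 0 → l₀ ≠ 1 ∧ l₁ ≠ 1 ∧ l₂ ≠ 1) →
    zeroOneEdge l₀ l₁ + zeroOneEdge l₂ l₃ = zeroOneEdge l₀ l₂ + zeroOneEdge l₁ l₃ := by
  set_option synthInstance.maxSize 1000 in decide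

/-- A variant of Sperner's lemma for the rectangle `[x₀, x₀ + n] × [y₀, y₀ + m]`. Let the label `0`
stand for the cluster of the left side in the square lattice, the label `1` for the cluster of the
bottom side in the close-packed lattice, and `2` for the other sites. The parity of the number of
edges with labels `0` and `1` in a row does not depend on the row: every face has an even number of
such edges on its boundary, and there are none on the left and, if the first cluster does not reach
it, on the right side. It is odd in the bottom row, but even in the top row if the second cluster does
not reach it. -/
theorem false_of_labelling (ℓ : ℤ × ℤ → Fin 3) (x₀ y₀ : ℤ) (n m : ℕ) (hn : 1 ≤ n)
    (hleft : ∀ j ≤ m, ℓ (x₀, y₀ + j) = 0) (hright : ∀ j ≤ m, ℓ (x₀ + n, y₀ + j) ≠ 0)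
    (hbot : ∀ i ≤ n, 1 ≤ i → ℓ (x₀ + i, y₀) = 1) (htop : ∀ i ≤ n, ℓ (x₀ + i, y₀ + m) ≠ 1)
    (h2 : ∀ e a b : ℤ × ℤ, x₀ ≤ e.1 → e.1 ≤ x₀ + n → y₀ ≤ e.2 → e.2 ≤ y₀ + m →
      squareLattice.Adj e a → closePacked.Adj e b → ℓ e = 2 → ℓ a = 0 → ℓ b ≠ 1) : False := by
  let f : ℤ × ℤ → ℤ × ℤ → ZMod 2 := fun v w => zeroOneEdge (ℓ v) (ℓ w)
  have hface : ∀ i j : ℕ, i < n → j < m →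
      f (x₀ + i, y₀ + j) (x₀ + (i + 1 : ℕ), y₀ + j) +
        f (x₀ + i, y₀ + (j + 1 : ℕ)) (x₀ + (i + 1 : ℕ), y₀ + (j + 1 : ℕ)) =
      f (x₀ + i, y₀ + j) (x₀ + i, y₀ + (j + 1 : ℕ)) +
        f (x₀ + (i + 1 : ℕ), y₀ + j) (x₀ + (i + 1 : ℕ), y₀ + (j + 1 : ℕ)) := by
    intro i j hi hj
    have key : ∀ e a b : ℤ × ℤ, squareLattice.Adj e a → x₀ + i ≤ e.1 ∧ e.1 ≤ x₀ + i + 1 →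
        y₀ + j ≤ e.2 ∧ e.2 ≤ y₀ + j + 1 → x₀ + i ≤ b.1 ∧ b.1 ≤ x₀ + i + 1 →
        y₀ + j ≤ b.2 ∧ b.2 ≤ y₀ + j + 1 → ℓ e = 2 → ℓ a = 0 → ℓ b ≠ 1 := by
      intro e a b hea he1 he2 hb1 hb2 hle hla hlb
      have heb : closePacked.Adj e b := by
        refine ⟨?_, ?_, ?_⟩
        · rintro rfl
          rw [hle] at hlb
          exact absurd hlb (by decide)
        · rw [abs_le]
          omega
        · rw [abs_le]
          omega
      exact h2 e a b (by omega) (by omega) (by omega) (by omega) hea heb hle hla hlb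
    have adj : ∀ a b : ℤ × ℤ, (b.1 = a.1 + 1 ∧ b.2 = a.2) ∨ (b.1 = a.1 ∧ b.2 = a.2 + 1) →
        squareLattice.Adj a b := by
      rintro ⟨a1, a2⟩ ⟨b1, b2⟩ h
      simp only [squareLattice_adj, Prod.mk.injEq]
      simp only at h
      omega
    have s01 := adj (x₀ + i, y₀ + j) (x₀ + (i + 1 : ℕ), y₀ + j) (by simp [add_assoc])
    have s02 := adj (x₀ + i, y₀ + j) (x₀ + i, y₀ + (j + 1 : ℕ)) (by simp [add_assoc])
    have s13 := adj (x₀ + (i + 1 : ℕ), y₀ + j) (x₀ + (i + 1 : ℕ), y₀ + (j + 1 : ℕ))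
      (by simp [add_assoc])
    have s23 := adj (x₀ + i, y₀ + (j + 1 : ℕ)) (x₀ + (i + 1 : ℕ), y₀ + (j + 1 : ℕ))
      (by simp [add_assoc])
    refine zeroOneEdge_face _ _ _ _ ?_ ?_ ?_ ?_ <;> rintro he (ha | ha)
    · refine ⟨?_, ?_, ?_⟩ <;> refine key _ _ _ s01 ?_ ?_ ?_ ?_ he ha <;> simp [add_assoc]
    · refine ⟨?_, ?_, ?_⟩ <;> refine key _ _ _ s02 ?_ ?_ ?_ ?_ he ha <;> simp [add_assoc]
    · refine ⟨?_, ?_, ?_⟩ <;> refine key _ _ _ s01.symm ?_ ?_ ?_ ?_ he ha <;> simp [add_assoc]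
    · refine ⟨?_, ?_, ?_⟩ <;> refine key _ _ _ s13 ?_ ?_ ?_ ?_ he ha <;> simp [add_assoc]
    · refine ⟨?_, ?_, ?_⟩ <;> refine key _ _ _ s02.symm ?_ ?_ ?_ ?_ he ha <;> simp [add_assoc]
    · refine ⟨?_, ?_, ?_⟩ <;> refine key _ _ _ s23 ?_ ?_ ?_ ?_ he ha <;> simp [add_assoc]
    · refine ⟨?_, ?_, ?_⟩ <;> refine key _ _ _ s13.symm ?_ ?_ ?_ ?_ he ha <;> simp [add_assoc]
    · refine ⟨?_, ?_, ?_⟩ <;> refine key _ _ _ s23.symm ?_ ?_ ?_ ?_ he ha <;> simp [add_assoc]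
  let R : ℕ → ZMod 2 := fun j =>
    ∑ i ∈ Finset.range n, f (x₀ + i, y₀ + j) (x₀ + (i + 1 : ℕ), y₀ + j)
  have hstep : ∀ j < m, R j + R (j + 1) = 0 := by
    intro j hj
    have h3 : f (x₀ + (0 : ℕ), y₀ + j) (x₀ + (0 : ℕ), y₀ + (j + 1 : ℕ)) = 0 := by
      have h := hleft j hj.le
      have h' := hleft (j + 1) hj
      simp only [f, Nat.cast_zero, add_zero, h, h']
      rfl
    have h4 : f (x₀ + n, y₀ + j) (x₀ + n, y₀ + (j + 1 : ℕ)) = 0 := by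
      simp only [f, zeroOneEdge, hright j hj.le, hright (j + 1) hj, false_and, and_false,
        or_false, if_false]
    simp only [R]
    rw [← Finset.sum_add_distrib, Finset.sum_congr rfl fun i hi =>
      hface i j (Finset.mem_range.1 hi) hj, sum_range_add_succ_zmod_two
        (fun i => f (x₀ + (i : ℕ), y₀ + j) (x₀ + (i : ℕ), y₀ + (j + 1 : ℕ))), h3, h4, add_zero]
  have hconst : ∀ j ≤ m, R j = R 0 := by
    intro j hj
    induction j with
    | zero => rfl
    | succ j ih => rw [← ih (by omega), ← CharTwo.add_eq_zero, add_comm]; exact hstep j (by omega)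
  have hRtop : R m = 0 := by
    refine Finset.sum_eq_zero fun i hi => ?_
    have hi := Finset.mem_range.1 hi
    simp only [f, zeroOneEdge, htop i hi.le, htop (i + 1) hi, false_and, and_false,
        or_false, if_false]
  have hRbot : R 0 = 1 := by
    obtain ⟨n, rfl⟩ : ∃ n', n = n' + 1 := ⟨n - 1, by omega⟩
    simp only [R]
    rw [Finset.sum_range_succ', Finset.sum_eq_zero, zero_add]
    · have h1 := hleft 0 (Nat.zero_le _)
      have h2 := hbot 1 (by omega) le_rfl
      simp only [Nat.cast_zero, add_zero] at h1 h2
      simp only [f, Nat.cast_zero, add_zero, zero_add, h1, h2]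
      rfl
    · intro i hi
      have hi := Finset.mem_range.1 hi
      have h1 := hbot (i + 1) (by omega) (by omega)
      have h2 := hbot (i + 1 + 1) (by omega) (by omega)
      simp only [f, Nat.cast_zero, add_zero, h1, h2]
      rfl
  rw [hconst m le_rfl, hRbot] at hRtop
  exact one_ne_zero hRtop

/-- The box with columns `-L, …, L` and rows `-M, …, M`. -/
def box (L M : ℤ) : Set (ℤ × ℤ) := {v | -L ≤ v.1 ∧ v.1 ≤ L ∧ -M ≤ v.2 ∧ v.2 ≤ M}

/-- The sites of `s` with value `c`. -/
def sitesWithValue (ω : Config) (c : Bool) (s : Set (ℤ × ℤ)) : Set (ℤ × ℤ) := {v ∈ s | ω v = c}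

open Classical in
/-- A box has a closed horizontal crossing in the square lattice or an open vertical crossing in the
close-packed lattice. For the proof, a closed column is added to the left of the box and an open row
below it. -/
theorem exists_closed_crossing_or_open_star_crossing (ω : Config) (L M : ℕ) :
    (∃ a ∈ sitesWithValue ω false (box L M), ∃ b : ℤ × ℤ, a.1 = -L ∧ b.1 = L ∧
      (edgesWithin squareLattice (sitesWithValue ω false (box L M))).Reachable a b) ∨
    (∃ a ∈ sitesWithValue ω true (box L M), ∃ b : ℤ × ℤ, a.2 = -M ∧ b.2 = M ∧
      (edgesWithin closePacked (sitesWithValue ω true (box L M))).Reachable a b) := by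
  set D₀ := sitesWithValue ω false (box L M)
  set D₁ := sitesWithValue ω true (box L M)
  by_contra! hcon
  obtain ⟨hcon₀, hcon₁⟩ := hcon
  let C : Set (ℤ × ℤ) := {v | v ∈ D₀ ∧ ∃ a ∈ D₀, a.1 = -L ∧
    (edgesWithin squareLattice D₀).Reachable a v}
  let U : Set (ℤ × ℤ) := {v | v ∈ D₁ ∧ ∃ a ∈ D₁, a.2 = -M ∧
    (edgesWithin closePacked D₁).Reachable a v}
  let ℓ : ℤ × ℤ → Fin 3 := fun v =>
    if v.1 = -L - 1 ∨ v ∈ C then 0 else if v.2 = -M - 1 ∨ v ∈ U then 1 else 2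
  have l0 : ∀ v, ℓ v = 0 ↔ v.1 = -L - 1 ∨ v ∈ C := by
    intro v
    simp only [ℓ]
    split_ifs with h h' <;> simp [h]
  have l1 : ∀ v, ℓ v = 1 ↔ ¬ (v.1 = -L - 1 ∨ v ∈ C) ∧ (v.2 = -M - 1 ∨ v ∈ U) := by
    intro v
    simp only [ℓ]
    by_cases h : v.1 = -L - 1 ∨ v ∈ C <;> by_cases h' : v.2 = -M - 1 ∨ v ∈ U <;> simp [h, h']
  have l2 : ∀ v, ℓ v = 2 ↔ ¬ (v.1 = -L - 1 ∨ v ∈ C) ∧ ¬ (v.2 = -M - 1 ∨ v ∈ U) := by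
    intro v
    simp only [ℓ]
    by_cases h : v.1 = -L - 1 ∨ v ∈ C <;> by_cases h' : v.2 = -M - 1 ∨ v ∈ U <;> simp [h, h']
  refine false_of_labelling ℓ (-L - 1) (-M - 1) (2 * L + 1) (2 * M + 1) (by omega) ?_ ?_ ?_ ?_ ?_
  · intro j _
    rw [l0]
    exact Or.inl rfl
  · intro j _ h
    rw [l0] at h
    rcases h with h | ⟨_, a, ha, haL, hr⟩
    · simp only at h
      push_cast at h
      omega
    · exact hcon₀ a ha _ haL (by push_cast; ring) hr
  · intro i _ hi
    rw [l1]
    refine ⟨?_, Or.inl rfl⟩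
    rintro (h | ⟨⟨hb, _⟩, _⟩)
    · simp only at h
      omega
    · have := hb.2.2.1
      simp only at this
      omega
  · intro i _ h
    rw [l1] at h
    rcases h.2 with h | ⟨_, a, ha, haL, hr⟩
    · simp only at h
      push_cast at h
      omega
    · exact hcon₁ a ha _ haL (by push_cast; ring) hr
  · intro e a b he1 he2 he3 he4 hea heb hle hla hlb
    rw [l2] at hle
    rw [l0] at hla
    rw [l1] at hlb
    obtain ⟨hleA, hleB⟩ := hle
    push Not at hleA hleB
    push_cast at he2 he4
    have hebox : e ∈ box L M := ⟨by omega, by omega, by omega, by omega⟩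
    cases hω : ω e with
    | false =>
      have heD : e ∈ D₀ := ⟨hebox, hω⟩
      refine hleA.2 ⟨heD, ?_⟩
      rcases hla with hla | ⟨haD, c, hc, hcL, hr⟩
      · refine ⟨e, heD, ?_, SimpleGraph.Reachable.refl _⟩
        rw [squareLattice_adj] at hea
        rcases hea with rfl | rfl | rfl | rfl <;> simp only at hla <;> omega
      · exact ⟨c, hc, hcL, hr.trans (SimpleGraph.Adj.reachable ⟨hea.symm, haD, heD⟩)⟩
    | true =>
      have heD : e ∈ D₁ := ⟨hebox, hω⟩
      refine hleB.2 ⟨heD, ?_⟩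
      rcases hlb.2 with hlb | ⟨hbD, c, hc, hcL, hr⟩
      · refine ⟨e, heD, ?_, SimpleGraph.Reachable.refl _⟩
        have := abs_le.1 heb.2.2
        omega
      · exact ⟨c, hc, hcL, hr.trans (SimpleGraph.Adj.reachable ⟨heb.symm, hbD, heD⟩)⟩

/-- A path of the square lattice in `s` that starts to the left of a `*`-path `Q` and ends to the
right of it meets `Q`, if `Q` starts above `s` and ends below `s`. Otherwise, the parity of the
number of edges of `Q` that cross the horizontal half-line to the left of a site would be constant
along the path in `s`, while it is even at the beginning and odd at the end. -/
theorem exists_mem_of_closed_crossing (k : ℕ) (Q : ℕ → ℤ × ℤ)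
    (hQ : ∀ j < k, closePacked.Adj (Q j) (Q (j + 1))) (s : Set (ℤ × ℤ))
    (hrow : ∀ v ∈ s, (Q k).2 < v.2 ∧ v.2 < (Q 0).2) {a b : ℤ × ℤ} (ha : a ∈ s)
    (hleft : ∀ j ≤ k, a.1 ≤ (Q j).1) (hright : ∀ j ≤ k, (Q j).1 < b.1)
    (hab : (edgesWithin squareLattice s).Reachable a b) : ∃ j ≤ k, Q j ∈ s := by
  by_contra! hcon
  have hb := mem_of_reachable_edgesWithin hab ha
  -- The half-line of `v` lies strictly between the rows of `v` and of the site above `v`; only the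
  -- lower ends of the edges that cross it are compared with `v`.
  let g : ℤ × ℤ → ℤ × ℤ → ℤ × ℤ → ZMod 2 := fun v c d =>
    if (c.2 = v.2 ∧ d.2 = v.2 + 1 ∧ c.1 < v.1) ∨ (d.2 = v.2 ∧ c.2 = v.2 + 1 ∧ d.1 < v.1)
    then 1 else 0
  let σ : ℤ × ℤ → ZMod 2 := fun v => ∑ j ∈ Finset.range k, g v (Q j) (Q (j + 1))
  have hne : ∀ v ∈ s, ∀ j ≤ k, (Q j).1 ≠ v.1 ∨ (Q j).2 ≠ v.2 := by
    intro v hv j hj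
    by_contra! h
    exact hcon j hj (by rwa [Prod.ext h.1 h.2])
  have hQ' : ∀ j < k, ((Q j).1 - (Q (j + 1)).1 ≤ 1 ∧ (Q (j + 1)).1 - (Q j).1 ≤ 1) ∧
      ((Q j).2 - (Q (j + 1)).2 ≤ 1 ∧ (Q (j + 1)).2 - (Q j).2 ≤ 1) := by
    intro j hj
    have h1 := abs_le.1 (hQ j hj).2.1
    have h2 := abs_le.1 (hQ j hj).2.2
    omega
  have hsum : ∀ (v : ℤ × ℤ) (w : ℤ × ℤ → ZMod 2),
      (∀ j < k, g v (Q j) (Q (j + 1)) = w (Q j) + w (Q (j + 1))) →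
      σ v = w (Q 0) + w (Q k) := by
    intro v w h
    rw [← sum_range_add_succ_zmod_two (fun j => w (Q j)) k]
    exact Finset.sum_congr rfl fun j hj => h j (Finset.mem_range.1 hj)
  have hhor : ∀ v ∈ s, ∀ w ∈ s, w.1 = v.1 + 1 → w.2 = v.2 → σ w = σ v := by
    intro v hv w hw h1 h2
    refine Finset.sum_congr rfl fun j hj => ?_
    have hj := Finset.mem_range.1 hj
    have n1 := hne v hv j hj.le
    have n2 := hne v hv (j + 1) hj
    refine if_congr ?_ rfl rfl
    omega
  have hver : ∀ v ∈ s, ∀ w ∈ s, w.1 = v.1 → w.2 = v.2 + 1 → σ w = σ v := by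
    intro v hv w hw h1 h2
    rw [← CharTwo.add_eq_zero]
    -- An edge crosses exactly one of the half-lines of `v` and `w` if and only if exactly one of
    -- its ends lies in the row of `w` to the left of `w`.
    have hs : σ w + σ v = ∑ j ∈ Finset.range k,
        ((fun j => if (Q j).2 = w.2 ∧ (Q j).1 < w.1 then (1 : ZMod 2) else 0) j +
         (fun j => if (Q j).2 = w.2 ∧ (Q j).1 < w.1 then (1 : ZMod 2) else 0) (j + 1)) := by
      simp only [σ]
      rw [← Finset.sum_add_distrib]
      refine Finset.sum_congr rfl fun j hj => ?_
      have hj := Finset.mem_range.1 hj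
      have n1 := hne v hv j hj.le
      have n2 := hne v hv (j + 1) hj
      have n3 := hne w hw j hj.le
      have n4 := hne w hw (j + 1) hj
      have hst := hQ' j hj
      simp only [g]
      split_ifs <;> first | omega | rfl
    rw [hs, sum_range_add_succ_zmod_two]
    have := hrow w hw
    rw [if_neg (by omega), if_neg (by omega), add_zero]
  have hconst : σ b = σ a := by
    refine reachable_mem_of_forall_adj (R := {v | σ v = σ a}) hab rfl ?_
    rintro v w ⟨hvw, hv, hw⟩ (h : σ v = σ a)
    rw [squareLattice_adj] at hvw
    change σ w = σ a
    rw [← h]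
    rcases hvw with h | h | h | h
    · exact hhor v hv w hw (by simp [h]) (by simp [h])
    · exact (hhor w hw v hv (by simp [h]) (by simp [h])).symm
    · exact hver v hv w hw (by simp [h]) (by simp [h])
    · exact (hver w hw v hv (by simp [h]) (by simp [h])).symm
  have ha0 : σ a = 0 := by
    refine Finset.sum_eq_zero fun j hj => if_neg ?_
    have hj := Finset.mem_range.1 hj
    have h1 := hleft j hj.le
    have h2 := hleft (j + 1) hj
    omega
  have hb1 : σ b = 1 := by
    rw [hsum b (fun c => if c.2 ≤ b.2 then 1 else 0)]
    · have := hrow b hb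
      rw [if_neg (by omega), if_pos (by omega), zero_add]
    · intro j hj
      have h1 := hright j hj.le
      have h2 := hright (j + 1) hj
      have hst := hQ' j hj
      simp only [g]
      split_ifs <;> first | omega | rfl
  rw [hconst, ha0] at hb1
  exact zero_ne_one hb1

/-! ### Closed paths between blocks are stable -/

/-- A set of closed sites each of which has two neighbours in the set is never opened. -/
theorem bootstrapFinal_eq_false_of_two_neighbors (ω : Config) (K : Set (ℤ × ℤ))
    (hK : ∀ v ∈ K, ∃ a ∈ K, ∃ b ∈ K, a ≠ b ∧ squareLattice.Adj v a ∧ squareLattice.Adj v b)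
    (hω : ∀ v ∈ K, ω v = false) : ∀ v ∈ K, bootstrapFinal ω v = false := by
  have hstep : ∀ ω' : Config, (∀ v ∈ K, ω' v = false) → ∀ v ∈ K, bootstrapStep ω' v = false := by
    intro ω' h v hv
    obtain ⟨a, ha, b, hb, hab, hva, hvb⟩ := hK v hv
    simp only [bootstrapStep, h v hv, Bool.false_or, decide_eq_false_iff_not, not_le]
    have hsub : (nearestNbrs v).filter (fun y => ω' y = true) ⊆ nearestNbrs v \ {a, b} := by
      intro y hy
      rw [Finset.mem_filter] at hy
      rw [Finset.mem_sdiff, Finset.mem_insert, Finset.mem_singleton]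
      refine ⟨hy.1, ?_⟩
      rintro (rfl | rfl)
      · simp [h _ ha] at hy
      · simp [h _ hb] at hy
    have hab' : ({a, b} : Finset (ℤ × ℤ)) ⊆ nearestNbrs v := by
      intro y hy
      rw [Finset.mem_insert, Finset.mem_singleton] at hy
      rcases hy with rfl | rfl
      exacts [hva, hvb]
    have h4 : (nearestNbrs v).card ≤ 4 := Finset.card_le_four
    have h1 := Finset.card_le_card hsub
    rw [Finset.card_sdiff_of_subset hab', Finset.card_pair hab] at h1
    omega
  have hiter : ∀ k : ℕ, ∀ v ∈ K, bootstrapStep^[k] ω v = false := by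
    intro k
    induction k with
    | zero => exact hω
    | succ k ih =>
      rw [Function.iterate_succ_apply']
      exact hstep _ ih
  intro v hv
  simp [bootstrapFinal, fun k => hiter k v hv]

/-- For `σ = ±1`, the `2 × 2` block with lower corner `v` that extends from `v` upwards, and to the
right if `σ = 1`, to the left if `σ = -1`. -/
def blockAt (σ : ℤ) (v : ℤ × ℤ) : Finset (ℤ × ℤ) :=
  {v, (v.1 + σ, v.2), (v.1, v.2 + 1), (v.1 + σ, v.2 + 1)}

theorem exists_two_neighbors_in_blockAt {σ : ℤ} (hσ : σ = 1 ∨ σ = -1) (z v : ℤ × ℤ)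
    (hv : v ∈ blockAt σ z) : ∃ a ∈ blockAt σ z, ∃ b ∈ blockAt σ z,
      a ≠ b ∧ squareLattice.Adj v a ∧ squareLattice.Adj v b := by
  obtain ⟨x, y⟩ := z
  simp only [blockAt, Finset.mem_insert, Finset.mem_singleton] at hv
  rcases hv with rfl | rfl | rfl | rfl
  · refine ⟨(x + σ, y), by simp [blockAt], (x, y + 1), by simp [blockAt], ?_⟩
    rcases hσ with rfl | rfl <;> simp [squareLattice_adj]
    omega
  · refine ⟨(x, y), by simp [blockAt], (x + σ, y + 1), by simp [blockAt], ?_⟩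
    rcases hσ with rfl | rfl <;> simp [squareLattice_adj]
  · refine ⟨(x, y), by simp [blockAt], (x + σ, y + 1), by simp [blockAt], ?_⟩
    rcases hσ with rfl | rfl <;> simp [squareLattice_adj, ← sub_eq_add_neg]
  · refine ⟨(x + σ, y), by simp [blockAt], (x, y + 1), by simp [blockAt], ?_⟩
    rcases hσ with rfl | rfl <;> simp [squareLattice_adj]

/-- A closed path in `B` between two closed `2 × 2` blocks remains closed forever; the blocks may
stick out of `B`. -/
theorem reachable_closed_bootstrapFinal (ω : Config) (B : Set (ℤ × ℤ)) {z z' : ℤ × ℤ}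
    (hz : z ∈ B) (hb : ∀ v ∈ blockAt 1 z, ω v = false) (hb' : ∀ v ∈ blockAt (-1) z', ω v = false)
    (hr : (edgesWithin squareLattice (sitesWithValue ω false B)).Reachable z z') :
    z ∈ sitesWithValue (bootstrapFinal ω) false B ∧
    (edgesWithin squareLattice (sitesWithValue (bootstrapFinal ω) false B)).Reachable z z' := by
  obtain ⟨p, hp⟩ := hr.exists_isPath
  have hz0 : z ∈ sitesWithValue ω false B := ⟨hz, hb z (by simp [blockAt])⟩
  have hmem : ∀ i, p.getVert i ∈ sitesWithValue ω false B := fun i =>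
    mem_of_reachable_edgesWithin ⟨p.take i⟩ hz0
  let K : Set (ℤ × ℤ) := {v | v ∈ blockAt 1 z ∨ v ∈ blockAt (-1) z' ∨ ∃ i, p.getVert i = v}
  have hK : ∀ v ∈ K, bootstrapFinal ω v = false := by
    apply bootstrapFinal_eq_false_of_two_neighbors ω K
    · have h1 : ∀ v ∈ blockAt 1 z, ∃ a ∈ K, ∃ b ∈ K, a ≠ b ∧ squareLattice.Adj v a ∧
          squareLattice.Adj v b := by
        intro v hv
        obtain ⟨a, ha, b, hb, h⟩ := exists_two_neighbors_in_blockAt (Or.inl rfl) z v hv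
        exact ⟨a, Or.inl ha, b, Or.inl hb, h⟩
      have h2 : ∀ v ∈ blockAt (-1) z', ∃ a ∈ K, ∃ b ∈ K, a ≠ b ∧ squareLattice.Adj v a ∧
          squareLattice.Adj v b := by
        intro v hv
        obtain ⟨a, ha, b, hb, h⟩ := exists_two_neighbors_in_blockAt (Or.inr rfl) z' v hv
        exact ⟨a, Or.inr (Or.inl ha), b, Or.inr (Or.inl hb), h⟩
      rintro v (hv | hv | ⟨i, rfl⟩)
      · exact h1 v hv
      · exact h2 v hv
      · rcases Nat.eq_zero_or_pos i with rfl | hi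
        · exact h1 _ (by simp [blockAt])
        · by_cases hil : i < p.length
          · refine ⟨p.getVert (i - 1), Or.inr (Or.inr ⟨_, rfl⟩), p.getVert (i + 1),
              Or.inr (Or.inr ⟨_, rfl⟩), fun h => ?_, ?_, (p.adj_getVert_succ hil).1⟩
            · have := hp.getVert_injOn (by simp; omega) (by simp; omega) h
              omega
            · have := (p.adj_getVert_succ (i := i - 1) (by omega)).1.symm
              rwa [Nat.sub_add_cancel hi] at this
          · rw [p.getVert_of_length_le (not_lt.1 hil)]
            exact h2 _ (by simp [blockAt])
    · rintro v (hv | hv | ⟨i, rfl⟩)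
      · exact hb v hv
      · exact hb' v hv
      · exact (hmem i).2
  have hmem' : ∀ i, p.getVert i ∈ sitesWithValue (bootstrapFinal ω) false B := fun i =>
    ⟨(hmem i).1, hK _ (Or.inr (Or.inr ⟨i, rfl⟩))⟩
  have hreach : ∀ i ≤ p.length,
      (edgesWithin squareLattice (sitesWithValue (bootstrapFinal ω) false B)).Reachable z
        (p.getVert i) := by
    intro i hi
    induction i with
    | zero => rw [p.getVert_zero]
    | succ i ih =>
      exact (ih (by omega)).trans (SimpleGraph.Adj.reachable
        ⟨(p.adj_getVert_succ (by omega)).1, hmem' i, hmem' (i + 1)⟩)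
  refine ⟨by simpa using hmem' 0, by simpa using hreach p.length le_rfl⟩

/-! ### Exploration of closed clusters -/

/-- Some `y` with `P y`; the value is `0` if there is none. -/
noncomputable def someRow (P : ℤ → Prop) : ℤ :=
  open Classical in if h : ∃ y, P y then h.choose else 0

theorem someRow_spec {P : ℤ → Prop} (h : ∃ y, P y) : P (someRow P) := by
  simp only [someRow, dif_pos h]
  exact h.choose_spec

theorem someRow_mem {P : ℤ → Prop} {M : ℕ} (h : ∀ y, P y → -M ≤ y ∧ y ≤ (M : ℤ)) :
    -M ≤ someRow P ∧ someRow P ≤ (M : ℤ) := by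
  by_cases hP : ∃ y, P y
  · exact h _ (someRow_spec hP)
  · simp only [someRow, dif_neg hP]
    omega

/-- For `σ = 1`, the part of the box with columns up to `c`; for `σ = -1`, the part with columns
from `-c` on. -/
def halfBox (σ L M c : ℤ) : Set (ℤ × ℤ) := {v ∈ box L M | σ * v.1 ≤ c}

/-- A closed path that crosses column `σ * c` yields a closed path to that column which does not go
beyond it. -/
theorem exists_reachable_column (σ L M c : ℤ) (hσ : σ = 1 ∨ σ = -1) (ω : Config) {a b : ℤ × ℤ}
    (ha : a ∈ sitesWithValue ω false (box L M)) (hac : σ * a.1 ≤ c) (hbc : c ≤ σ * b.1)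
    (hr : (edgesWithin squareLattice (sitesWithValue ω false (box L M))).Reachable a b) :
    ∃ z, σ * z.1 = c ∧ z ∈ sitesWithValue ω false (halfBox σ L M c) ∧
      (edgesWithin squareLattice (sitesWithValue ω false (halfBox σ L M c))).Reachable a z := by
  set D := sitesWithValue ω false (halfBox σ L M c) with hD
  have ha' : a ∈ D := ⟨⟨ha.1, hac⟩, ha.2⟩
  by_contra! hcon
  have hR : b ∈ {v | (edgesWithin squareLattice D).Reachable a v} := by
    refine reachable_mem_of_forall_adj hr (SimpleGraph.Reachable.refl a) ?_
    rintro x y ⟨hxy, -, hy⟩ (hx : (edgesWithin squareLattice D).Reachable a x)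
    have hxD := mem_of_reachable_edgesWithin hx ha'
    have hxc : σ * x.1 < c := lt_of_le_of_ne hxD.1.2 fun h => hcon x h hxD hx
    have hyc : σ * y.1 ≤ c := by
      rw [squareLattice_adj] at hxy
      rcases hσ with rfl | rfl <;> rcases hxy with rfl | rfl | rfl | rfl <;> simp only at hxc ⊢ <;>
        omega
    exact hx.trans (SimpleGraph.Adj.reachable ⟨hxy, hxD, ⟨hy.1, hyc⟩, hy.2⟩)
  have hbD := mem_of_reachable_edgesWithin hR ha'
  exact hcon b (le_antisymm hbD.1.2 hbc) hbD hR

/-- The sites `v` with `-L ≤ σ * v.1 ≤ c` and `-M ≤ v.2 ≤ M + 1`, for `σ = ±1`. The row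
`M + 1` is included because a block whose lower corner is in the box may stick out of the box. -/
noncomputable def exploredSites (σ L M c : ℤ) : Finset (ℤ × ℤ) :=
  (Finset.Icc (-L) c ×ˢ Finset.Icc (-M) (M + 1)).image fun v => (σ * v.1, v.2)

theorem mem_exploredSites {σ L M c : ℤ} (hσ : σ = 1 ∨ σ = -1) {v : ℤ × ℤ} :
    v ∈ exploredSites σ L M c ↔ (-L ≤ σ * v.1 ∧ σ * v.1 ≤ c) ∧ -M ≤ v.2 ∧ v.2 ≤ M + 1 := by
  have h2 : σ * σ = 1 := by rcases hσ with rfl | rfl <;> rfl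
  simp only [exploredSites, Finset.mem_image, Finset.mem_product, Finset.mem_Icc]
  constructor
  · rintro ⟨w, hw, rfl⟩
    simpa [← mul_assoc, h2] using hw
  · intro h
    exact ⟨(σ * v.1, v.2), h, by simp [← mul_assoc, h2]⟩

theorem sitesWithValue_congr {ω ω' : Config} {c : Bool} {s : Set (ℤ × ℤ)}
    (h : ∀ v ∈ s, ω v = ω' v) : sitesWithValue ω c s = sitesWithValue ω' c s := by
  ext v
  exact and_congr_right fun hv => by rw [h v hv]

/-- It is unlikely that closed paths lead from the random set `Src ω` to the side of the box in
direction `σ`, while none leads to a closed block in the last `L - N` columns before that side. -/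
theorem productBernoulli_real_no_block_le (p : unitInterval) (σ : ℤ) (hσ : σ = 1 ∨ σ = -1)
    (L M N k : ℕ) (hL : N + 2 * k ≤ L) (Src : Config → Set (ℤ × ℤ))
    (hdep : DependsOn Src (exploredSites σ L M N))
    (hsub : ∀ ω, ∀ a ∈ Src ω, a ∈ sitesWithValue ω false (box L M) ∧ σ * a.1 ≤ N) :
    (productBernoulli p).real {ω |
      (∃ a ∈ Src ω, ∃ b : ℤ × ℤ, σ * b.1 = L ∧
        (edgesWithin squareLattice (sitesWithValue ω false (box L M))).Reachable a b) ∧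
      ¬ ∃ a ∈ Src ω, ∃ z ∈ box L M, (N + 1 ≤ σ * z.1 ∧ σ * z.1 + 1 ≤ L) ∧
        (∀ v ∈ blockAt σ z, ω v = false) ∧
        (edgesWithin squareLattice (sitesWithValue ω false (box L M))).Reachable a z} ≤
      (1 - (1 - (p : ℝ)) ^ 4) ^ k := by
  have hσ2 : σ * σ = 1 := by rcases hσ with rfl | rfl <;> rfl
  -- The `i`-th attempt to find a block uses the columns `c i + 1` and `c i + 2` (times `σ`), next
  -- to a site `(σ * c i, y)` that is reached within the columns up to `c i`.
  let c : ℕ → ℤ := fun i => N + 2 * i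
  let P : ℕ → Config → ℤ → Prop := fun i ω y =>
    (σ * c i, y) ∈ sitesWithValue ω false (halfBox σ L M (c i)) ∧ ∃ a ∈ Src ω,
      (edgesWithin squareLattice (sitesWithValue ω false (halfBox σ L M (c i)))).Reachable a
        (σ * c i, y)
  let T : ℕ → Config → Finset (ℤ × ℤ) := fun i ω =>
    blockAt σ (σ * (c i + 1), someRow (P i ω))
  have hPM : ∀ i ω, -(M : ℤ) ≤ someRow (P i ω) ∧ someRow (P i ω) ≤ (M : ℤ) := fun i ω =>
    someRow_mem fun y hy => hy.1.1.1.2.2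
  have hPdep : ∀ i, DependsOn (P i) (exploredSites σ L M (c i)) := by
    intro i ω ω' h
    have h1 : sitesWithValue ω false (halfBox σ L M (c i)) =
        sitesWithValue ω' false (halfBox σ L M (c i)) := by
      refine sitesWithValue_congr fun v hv => h v ?_
      rw [Finset.mem_coe, mem_exploredSites hσ]
      obtain ⟨⟨h1, h2, h3, h4⟩, h5⟩ := hv
      refine ⟨⟨?_, h5⟩, h3, by omega⟩
      rcases hσ with rfl | rfl <;> omega
    have h2 : Src ω = Src ω' := by
      refine hdep fun v hv => h v ?_
      rw [Finset.mem_coe, mem_exploredSites hσ] at hv ⊢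
      simp only [c]
      omega
    simp only [P, h1, h2]
  have hT : ∀ i ω v, v ∈ T i ω →
      (c i + 1 ≤ σ * v.1 ∧ σ * v.1 ≤ c i + 2) ∧ -M ≤ v.2 ∧ v.2 ≤ (M : ℤ) + 1 := by
    intro i ω v hv
    have := hPM i ω
    simp only [T, blockAt, Finset.mem_insert, Finset.mem_singleton] at hv
    rcases hv with rfl | rfl | rfl | rfl <;> simp only [mul_add, ← mul_assoc, hσ2] <;> omega
  refine (measureReal_mono (fun ω hω => ?_) (measure_ne_top _ _)).trans
    (productBernoulli_real_forall_trials_le p (fun i => exploredSites σ L M (c i)) T ?_ ?_ ?_ ?_ 4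
      ?_ k)
  · obtain ⟨⟨a, ha, b, hb, hr⟩, hno⟩ := hω
    intro i hi
    by_contra! hcon
    have hci : c i + 2 ≤ L := by
      simp only [c]
      omega
    obtain ⟨z, hzc, hzD, hz⟩ := exists_reachable_column σ L M (c i) hσ ω (hsub ω a ha).1
      ((hsub ω a ha).2.trans (by simp only [c]; omega)) (by omega) hr
    have hzeq : z = (σ * c i, z.2) := by
      refine Prod.ext ?_ rfl
      simp [← hzc, ← mul_assoc, hσ2]
    have hPex : ∃ y, P i ω y := by
      refine ⟨z.2, ?_⟩
      simp only [P]
      rw [← hzeq]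
      exact ⟨hzD, a, ha, hz⟩
    obtain ⟨hw, a', ha', hr'⟩ := someRow_spec hPex
    have hsubset : sitesWithValue ω false (halfBox σ L M (c i)) ⊆
        sitesWithValue ω false (box L M) := fun v hv => ⟨hv.1.1, hv.2⟩
    have hblock : ∀ v ∈ T i ω, ω v = false := fun v hv => by simpa using hcon v hv
    have hzbox : (σ * (c i + 1), someRow (P i ω)) ∈ box L M := by
      have := hPM i ω
      refine ⟨?_, ?_, this⟩ <;> simp only [c] at hci ⊢ <;> rcases hσ with rfl | rfl <;> omega
    refine hno ⟨a', ha', _, hzbox, ?_, hblock, (hr'.mono (edgesWithin_mono _ hsubset)).trans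
      (SimpleGraph.Adj.reachable ⟨?_, hsubset hw, hzbox, hblock _ (by simp [T, blockAt])⟩)⟩
    · simp only [← mul_assoc, hσ2, one_mul]
      simp only [c] at hci ⊢
      omega
    · rw [squareLattice_adj]
      rcases hσ with rfl | rfl <;> simp
      omega
  · intro i j hij v hv
    rw [mem_exploredSites hσ] at hv ⊢
    simp only [c] at hv ⊢
    omega
  · intro i ω ω' h
    simp only [T, hPdep i h]
  · intro i ω v hv
    have := hT i ω v hv
    rw [mem_exploredSites hσ]
    simp only [c] at this ⊢
    push_cast
    omega
  · intro i ω
    refine Finset.disjoint_left.2 fun v hv hv' => ?_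
    have := hT i ω v hv'
    rw [mem_exploredSites hσ] at hv
    omega
  · exact fun i ω => Finset.card_le_four

/-! ### Surviving closed crossings -/

/-- Outside an event of small probability, a closed crossing of the box `[-L, L] × [-M, M]` implies
that the final configuration has a closed path in this box from the right of column `N` to the left
of column `-N`. -/
theorem exists_bad_set (p : unitInterval) (L M N k : ℕ) (hL : N + 2 * k ≤ L) :
    ∃ Bad : Set Config, (productBernoulli p).real Bad ≤ 2 * (1 - (1 - (p : ℝ)) ^ 4) ^ k ∧
      ∀ ω ∉ Bad, (∃ a ∈ sitesWithValue ω false (box L M), ∃ b : ℤ × ℤ, a.1 = -L ∧ b.1 = L ∧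
        (edgesWithin squareLattice (sitesWithValue ω false (box L M))).Reachable a b) →
      ∃ z z' : ℤ × ℤ, N < z.1 ∧ z'.1 < -N ∧
        z ∈ sitesWithValue (bootstrapFinal ω) false (box L M) ∧
        (edgesWithin squareLattice
          (sitesWithValue (bootstrapFinal ω) false (box L M))).Reachable z z' := by
  -- `A` is the set of starting points of the exploration to the right; `B`, the lower left corners
  -- of the blocks in the right strip, is the set of starting points of the exploration to the left.
  let A : Config → Set (ℤ × ℤ) := fun ω => {a ∈ sitesWithValue ω false (box L M) | a.1 = -L}
  let B : Config → Set (ℤ × ℤ) := fun ω => {z ∈ sitesWithValue ω false (box L M) |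
    (N + 1 ≤ z.1 ∧ z.1 + 1 ≤ L) ∧ ∀ v ∈ blockAt 1 z, ω v = false}
  have hA := productBernoulli_real_no_block_le p 1 (Or.inl rfl) L M N k hL A
    (by
      intro ω ω' h
      ext a
      simp only [A, sitesWithValue, Set.mem_ofPred_eq]
      refine and_congr_left fun haL => and_congr_right fun hab => ?_
      rw [h a ?_]
      rw [Finset.mem_coe, mem_exploredSites (Or.inl rfl)]
      obtain ⟨h1, h2, h3, h4⟩ := hab
      omega)
    (fun ω a ha => ⟨ha.1, by rw [ha.2]; omega⟩)
  have hB := productBernoulli_real_no_block_le p (-1) (Or.inr rfl) L M N k hL B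
    (by
      intro ω ω' h
      ext z
      simp only [B, sitesWithValue, Set.mem_ofPred_eq, and_assoc]
      refine and_congr_right fun hzb => ?_
      have hz : ∀ v ∈ blockAt 1 z, N + 1 ≤ z.1 → z.1 + 1 ≤ L → ω v = ω' v := by
        intro v hv h1 h2
        refine h v ?_
        rw [Finset.mem_coe, mem_exploredSites (Or.inr rfl)]
        obtain ⟨h3, h4, h5, h6⟩ := hzb
        simp only [blockAt, Finset.mem_insert, Finset.mem_singleton] at hv
        rcases hv with rfl | rfl | rfl | rfl <;> omega
      constructor <;>
      · rintro ⟨h0, h1, h2, h3⟩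
        exact ⟨(hz z (by simp [blockAt]) h1 h2) ▸ h0, h1, h2, fun v hv => hz v hv h1 h2 ▸ h3 v hv⟩)
    (fun ω a ha => ⟨ha.1, by have := ha.2.1.1; omega⟩)
  refine ⟨_, (measureReal_union_le _ _).trans ((add_le_add hA hB).trans_eq (two_mul _).symm), ?_⟩
  rintro ω hω ⟨a, ha, b, haL, hbL, hab⟩
  simp only [Set.mem_union, Set.mem_ofPred_eq, not_or, not_and, not_not] at hω
  obtain ⟨a', ha', z, hz, hzc, hzb, ha'z⟩ := hω.1 ⟨a, ⟨ha, haL⟩, b, by rw [hbL, one_mul], hab⟩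
  rw [one_mul] at hzc
  obtain ⟨z₁, hz₁, z', hz', hzc', hzb', hzz'⟩ := hω.2 ⟨z,
    ⟨⟨hz, hzb z (by simp [blockAt])⟩, hzc, hzb⟩, a', by rw [ha'.2]; ring, ha'z.symm⟩
  have h1 := hz₁.2.1.1
  refine ⟨z₁, z', by omega, by omega, ?_⟩
  exact reachable_closed_bootstrapFinal ω (box L M) hz₁.1.1 hz₁.2.2 hzb' hzz'

/-! ### Crossings of rectangles and of boxes of the lattice -/

theorem HasVerticalCrossing.mono {δ b h : ℝ} {ω ω' : Config}
    (hω : ∀ x, ω x = true → ω' x = true) (H : HasVerticalCrossing δ b h ω) :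
    HasVerticalCrossing δ b h ω' := by
  obtain ⟨m, x, hm, ⟨hadj, hinj, hopen⟩, hrest⟩ := H
  exact ⟨m, x, hm, ⟨hadj, hinj, fun j hj => hω _ (hopen j hj)⟩, hrest⟩

theorem not_hasVerticalCrossing_of_reachable {δ b h : ℝ} (hδ : 0 < δ) {ω : Config} {L M N : ℕ}
    (hM : δ * M < h / 2) (hN : b / 2 ≤ δ * N) {z z' : ℤ × ℤ} (hz : N < z.1) (hz' : z'.1 < -N)
    (hzD : z ∈ sitesWithValue ω false (box L M))
    (hr : (edgesWithin squareLattice (sitesWithValue ω false (box L M))).Reachable z z') :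
    ¬ HasVerticalCrossing δ b h ω := by
  rintro ⟨m, x, hm, ⟨hadj, -, hopen⟩, hrect, ⟨t, ht, htop⟩, ⟨u, hu, hbot⟩⟩
  have h0 : h / 2 ≤ δ * ((x 0).2 : ℝ) := by
    by_contra! hlt
    have hconv : Convex ℝ {v : ℝ × ℝ | v.2 < h / 2} :=
      convex_halfSpace_lt (LinearMap.snd ℝ ℝ ℝ).isLinear _
    have := hconv.segment_subset (x := scaled δ (x 0)) hlt (hrect 1 le_rfl hm).2.2 ht
    exact this.ne htop.2
  have h1 : δ * ((x (m + 1)).2 : ℝ) ≤ -h / 2 := by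
    by_contra! hlt
    have hconv : Convex ℝ {v : ℝ × ℝ | -h / 2 < v.2} :=
      convex_halfSpace_gt (LinearMap.snd ℝ ℝ ℝ).isLinear _
    have := hconv.segment_subset (y := scaled δ (x (m + 1))) (hrect m hm le_rfl).2.1 hlt hu
    exact this.ne' hbot.2
  have hrow0 : (M : ℤ) < (x 0).2 := by
    have : δ * (M : ℝ) < δ * ((x 0).2 : ℝ) := hM.trans_le h0
    exact_mod_cast lt_of_mul_lt_mul_left this hδ.le
  have hrow1 : (x (m + 1)).2 < -(M : ℤ) := by
    have : δ * ((x (m + 1)).2 : ℝ) < δ * (-(M : ℝ)) := by linarith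
    exact_mod_cast lt_of_mul_lt_mul_left this hδ.le
  have hcol : ∀ j, 1 ≤ j → j ≤ m → -(N : ℤ) < (x j).1 ∧ (x j).1 < N := by
    intro j h1 h2
    obtain ⟨⟨h3, h4⟩, -⟩ := hrect j h1 h2
    simp only [scaled] at h3 h4
    have h5 : δ * (-(N : ℝ)) < δ * ((x j).1 : ℝ) := by linarith
    have h6 : δ * ((x j).1 : ℝ) < δ * (N : ℝ) := by linarith
    exact ⟨by exact_mod_cast lt_of_mul_lt_mul_left h5 hδ.le,
      by exact_mod_cast lt_of_mul_lt_mul_left h6 hδ.le⟩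
  have hcol' : ∀ j ≤ m + 1, -(N : ℤ) ≤ (x j).1 ∧ (x j).1 ≤ N := by
    intro j hj
    rcases Nat.eq_zero_or_pos j with rfl | hj0
    · have h2 := hcol 1 le_rfl hm
      have h3 := abs_le.1 (hadj 0 (by omega)).2.1
      simp only [zero_add] at h3
      omega
    · rcases Nat.lt_or_ge m j with hj1 | hj1
      · obtain rfl : j = m + 1 := by omega
        have h2 := hcol m hm le_rfl
        have h3 := abs_le.1 (hadj m (by omega)).2.1
        omega
      · have := hcol j hj0 hj1
        omega
  obtain ⟨j, hj, hjs⟩ := exists_mem_of_closed_crossing (m + 1) x hadj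
    (sitesWithValue ω false (box L M))
    (fun v hv => ⟨hrow1.trans_le hv.1.2.2.1, hv.1.2.2.2.trans_lt hrow0⟩)
    (mem_of_reachable_edgesWithin hr hzD) (fun j hj => hz'.le.trans (hcol' j hj).1)
    (fun j hj => (hcol' j hj).2.trans_lt hz) hr.symm
  have := hjs.2
  rw [hopen j hj] at this
  exact Bool.noConfusion this

theorem segment_inter_horizontal_nonempty {u v : ℝ × ℝ} {l r c : ℝ} (hu : u.1 ∈ Set.Icc l r)
    (hv : v.1 ∈ Set.Icc l r) (huc : c ≤ u.2) (hvc : v.2 ≤ c) :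
    (segment ℝ u v ∩ Set.Icc l r ×ˢ {c}).Nonempty := by
  have hpre : IsPreconnected (segment ℝ u v) := (convex_segment u v).isPreconnected
  obtain ⟨w, hw, hwc⟩ := hpre.intermediate_value (right_mem_segment ℝ u v)
    (left_mem_segment ℝ u v) (f := Prod.snd) continuous_snd.continuousOn ⟨hvc, huc⟩
  have hconv : Convex ℝ {v : ℝ × ℝ | v.1 ∈ Set.Icc l r} :=
    (convex_Icc l r).linear_preimage (LinearMap.fst ℝ ℝ ℝ)
  exact ⟨w, hw, hconv.segment_subset hu hv hw, hwc⟩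

theorem hasVerticalCrossing_of_reachable {δ b h : ℝ} (hδ : 0 < δ) (hδh : δ < h) {ω : Config}
    {L M : ℕ} (hL : δ * L < b / 2) (hM : h / 2 ≤ δ * M) {a c : ℤ × ℤ} (ha : a.2 = -M)
    (hc : c.2 = M) (haD : a ∈ sitesWithValue ω true (box L M))
    (hr : (edgesWithin closePacked (sitesWithValue ω true (box L M))).Reachable a c) :
    HasVerticalCrossing δ b h ω := by
  classical
  obtain ⟨p, hp⟩ := hr.symm.exists_isPath
  have hmem : ∀ i, p.getVert i ∈ sitesWithValue ω true (box L M) := fun i =>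
    mem_of_reachable_edgesWithin (hr.trans ⟨p.take i⟩) haD
  have hadj : ∀ i < p.length, closePacked.Adj (p.getVert i) (p.getVert (i + 1)) := fun i hi =>
    (p.adj_getVert_succ hi).1
  have hcol : ∀ i, (scaled δ (p.getVert i)).1 ∈ Set.Ioo (-b / 2) (b / 2) := by
    intro i
    obtain ⟨⟨h1, h2, -⟩, -⟩ := hmem i
    have h1' : -(L : ℝ) ≤ ((p.getVert i).1 : ℝ) := by exact_mod_cast h1
    have h2' : ((p.getVert i).1 : ℝ) ≤ L := by exact_mod_cast h2
    have h3 := mul_le_mul_of_nonneg_left h1' hδ.le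
    have h4 := mul_le_mul_of_nonneg_left h2' hδ.le
    constructor <;> simp only [scaled] <;> linarith
  have hcol' : ∀ i, (scaled δ (p.getVert i)).1 ∈ Set.Icc (-b / 2) (b / 2) := fun i =>
    Set.Ioo_subset_Icc_self (hcol i)
  -- the first site at or below the bottom side, and the last one before it at or above the top side
  have hlast : (scaled δ (p.getVert p.length)).2 ≤ -h / 2 := by
    rw [p.getVert_length]
    simp only [scaled, ha]
    push_cast
    linarith
  have hex : ∃ j, (scaled δ (p.getVert j)).2 ≤ -h / 2 := ⟨_, hlast⟩
  let j := Nat.find hex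
  have hj : (scaled δ (p.getVert j)).2 ≤ -h / 2 := Nat.find_spec hex
  have hjmin : ∀ i < j, -h / 2 < (scaled δ (p.getVert i)).2 := fun i hi =>
    not_le.1 (Nat.find_min hex hi)
  have hjlen : j ≤ p.length := Nat.find_min' hex hlast
  have h0 : h / 2 ≤ (scaled δ (p.getVert 0)).2 := by
    rw [p.getVert_zero]
    simp only [scaled, hc]
    exact_mod_cast hM
  let i := Nat.findGreatest (fun i => h / 2 ≤ (scaled δ (p.getVert i)).2) j
  have hi : h / 2 ≤ (scaled δ (p.getVert i)).2 :=
    Nat.findGreatest_spec (P := fun i => h / 2 ≤ (scaled δ (p.getVert i)).2) (Nat.zero_le j) h0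
  have himax : ∀ l, i < l → l ≤ j → (scaled δ (p.getVert l)).2 < h / 2 := fun l h1 h2 =>
    not_le.1 (Nat.findGreatest_is_greatest h1 h2)
  have hij : i < j := lt_of_le_of_ne (Nat.findGreatest_le j) fun h => by
    rw [h] at hi
    linarith
  have hij' : i + 1 < j := by
    refine lt_of_le_of_ne hij fun h => ?_
    have h1 := (abs_le.1 (hadj i (by omega)).2.2).2
    have h2 : ((p.getVert i).2 : ℝ) - ((p.getVert (i + 1)).2 : ℝ) ≤ 1 := by exact_mod_cast h1
    rw [h] at h2
    have h3 := mul_le_mul_of_nonneg_left h2 hδ.le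
    simp only [scaled] at hi hj
    linarith
  refine ⟨j - i - 1, fun l => p.getVert (i + l), by omega, ⟨?_, ?_, ?_⟩, ?_, ?_, ?_⟩
  · intro l hl
    exact hadj (i + l) (by omega)
  · intro l hl l' hl' h
    simp only [Set.mem_Iic] at hl hl'
    have := hp.getVert_injOn (by simp; omega) (by simp; omega) h
    omega
  · exact fun l _ => (hmem _).2
  · intro l h1 h2
    exact ⟨hcol _, hjmin _ (by omega), himax _ (by omega) (by omega)⟩
  · exact segment_inter_horizontal_nonempty (hcol' _) (hcol' _) hi
      (himax (i + 1) (by omega) (by omega)).le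
  · have h1 : i + (j - i - 1 + 1) = j := by omega
    have h2 := hjmin (i + (j - i - 1)) (by omega)
    simp only [h1]
    exact segment_inter_horizontal_nonempty (hcol' _) (hcol' _) h2.le hj

/-! ### Comparison of crossing probabilities -/

theorem configAt_eq_true_of_open (ω : Config) (n : ℕ∞) (x : ℤ × ℤ) (h : ω x = true) :
    configAt ω n x = true := by
  have hiter : ∀ k : ℕ, bootstrapStep^[k] ω x = true := by
    intro k
    induction k with
    | zero => exact h
    | succ k ih =>
      rw [Function.iterate_succ_apply']
      exact bootstrapStep_of_open ih
  induction n using ENat.recTopCoe with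
  | top =>
    change bootstrapFinal ω x = true
    simp only [bootstrapFinal, decide_eq_true_eq]
    exact ⟨0, h⟩
  | coe n => exact hiter n

theorem configAt_top_eq_true (ω : Config) (n : ℕ∞) (x : ℤ × ℤ) (h : configAt ω n x = true) :
    configAt ω ⊤ x = true := by
  induction n using ENat.recTopCoe with
  | top => exact h
  | coe n =>
    change bootstrapFinal ω x = true
    simp only [bootstrapFinal, decide_eq_true_eq]
    exact ⟨n, h⟩

theorem crossingProb_zero_le (p : unitInterval) (δ b h : ℝ) (n : ℕ∞) :
    crossingProb p δ b h 0 ≤ crossingProb p δ b h n :=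
  measureReal_mono (fun ω hω => HasVerticalCrossing.mono
    (fun x hx => configAt_eq_true_of_open ω n x hx) hω) (measure_ne_top _ _)

theorem crossingProb_le_top (p : unitInterval) (δ b h : ℝ) (n : ℕ∞) :
    crossingProb p δ b h n ≤ crossingProb p δ b h ⊤ :=
  measureReal_mono (fun ω hω => HasVerticalCrossing.mono
    (fun x hx => configAt_top_eq_true ω n x hx) hω) (measure_ne_top _ _)

/-- Comparison of the final configuration in the rectangle with sides `b`, `h` with the initial
configuration in the rectangle with sides `b'`, `h'`. In units of the mesh, `2 * N` and `2 * L` are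
about the widths of the two rectangles, and `2 * M` is a height between those of the two. -/
theorem crossingProb_top_le (p : unitInterval) {δ b h b' h' : ℝ} (hδ : 0 < δ) (hδh' : δ < h')
    (L M N k : ℕ) (hL : N + 2 * k ≤ L) (hδM : δ * M < h / 2) (hδM' : h' / 2 ≤ δ * M)
    (hδN : b / 2 ≤ δ * N) (hδL : δ * L < b' / 2) :
    crossingProb p δ b h ⊤ ≤ crossingProb p δ b' h' 0 + 2 * (1 - (1 - (p : ℝ)) ^ 4) ^ k := by
  obtain ⟨Bad, hBad, hgood⟩ := exists_bad_set p L M N k hL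
  have hsub : {ω | HasVerticalCrossing δ b h (configAt ω ⊤)} ⊆
      {ω | HasVerticalCrossing δ b' h' (configAt ω 0)} ∪ Bad := by
    intro ω hω
    by_contra hcon
    rw [Set.mem_union, not_or] at hcon
    obtain ⟨hno, hωB⟩ := hcon
    rcases exists_closed_crossing_or_open_star_crossing ω L M with hclosed | hopen
    · obtain ⟨z, z', hz, hz', hzD, hr⟩ := hgood ω hωB hclosed
      exact not_hasVerticalCrossing_of_reachable hδ hδM hδN hz hz' hzD hr hω
    · obtain ⟨a, ha, c, haM, hcM, hr⟩ := hopen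
      exact hno (hasVerticalCrossing_of_reachable hδ hδh' hδL hδM' haM hcM ha hr)
  calc crossingProb p δ b h ⊤
      ≤ (productBernoulli p).real ({ω | HasVerticalCrossing δ b' h' (configAt ω 0)} ∪ Bad) :=
        measureReal_mono hsub (measure_ne_top _ _)
    _ ≤ _ := (measureReal_union_le _ _).trans (add_le_add_right hBad _)

theorem eventually_crossingProb_top_le (p : unitInterval) {b h b' h' : ℝ} (hb : 0 < b)
    (hbb' : b < b') (hh' : 0 < h') (hh'h : h' < h) :
    ∀ᶠ δ : ℝ in 𝓝[>] 0, crossingProb p δ b h ⊤ ≤ crossingProb p δ b' h' 0 +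
      2 * (1 - (1 - (p : ℝ)) ^ 4) ^ ⌊(b' - b) / 8 * δ⁻¹⌋₊ := by
  have hsmall : ∀ c : ℝ, 0 < c → ∀ᶠ δ : ℝ in 𝓝[>] 0, δ < c := fun c hc =>
    (eventually_lt_nhds hc).filter_mono nhdsWithin_le_nhds
  filter_upwards [self_mem_nhdsWithin, hsmall h' hh', hsmall ((b' - b) / 4) (by linarith),
    hsmall ((h - h') / 2) (by linarith)] with δ (hδ : 0 < δ) hδh' hδb hδh
  have hcancel : ∀ c : ℝ, δ * (c * δ⁻¹) = c := fun c => by field_simp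
  set N := ⌈b / 2 * δ⁻¹⌉₊ with hN
  set k := ⌊(b' - b) / 8 * δ⁻¹⌋₊ with hk
  have hδi : 0 < δ⁻¹ := inv_pos.2 hδ
  have hN1 : b / 2 ≤ δ * N := by
    rw [← hcancel (b / 2)]
    exact mul_le_mul_of_nonneg_left (Nat.le_ceil _) hδ.le
  have hN2 : δ * N < b / 2 + δ := by
    have := mul_lt_mul_of_pos_left (Nat.ceil_lt_add_one (a := b / 2 * δ⁻¹) (by positivity)) hδ
    rwa [mul_add, hcancel, mul_one] at this
  have hk1 : δ * k ≤ (b' - b) / 8 := by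
    rw [← hcancel ((b' - b) / 8)]
    exact mul_le_mul_of_nonneg_left
      (Nat.floor_le (mul_nonneg (by linarith) hδi.le)) hδ.le
  -- `M` is the largest integer with `δ * M < h / 2`
  obtain ⟨M, hM⟩ : ∃ M, ⌈h / 2 * δ⁻¹⌉₊ = M + 1 :=
    ⟨_, (Nat.succ_pred_eq_of_pos (Nat.ceil_pos.2 (mul_pos (by linarith) hδi))).symm⟩
  have hM1 : δ * M < h / 2 := by
    have h1 : (M : ℝ) < h / 2 * δ⁻¹ := Nat.lt_ceil.1 (by omega)
    have := mul_lt_mul_of_pos_left h1 hδ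
    rwa [hcancel] at this
  have hM2 : h / 2 ≤ δ * M + δ := by
    have h1 : h / 2 * δ⁻¹ ≤ (M : ℝ) + 1 := by exact_mod_cast hM ▸ Nat.le_ceil (h / 2 * δ⁻¹)
    have := mul_le_mul_of_nonneg_left h1 hδ.le
    rwa [hcancel, mul_add, mul_one] at this
  refine crossingProb_top_le p hδ hδh' (N + 2 * k) M N k le_rfl hM1 (by linarith) hN1 ?_
  push_cast
  linarith

theorem crossingProb_one (δ b h : ℝ) (n : ℕ∞) :
    crossingProb 1 δ b h n = crossingProb 1 δ b h 0 := by
  have hae : ∀ᵐ ω ∂productBernoulli 1, ∀ x, ω x = true := by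
    rw [ae_all_iff]
    intro x
    have h0 := productBernoulli_real_forall_closed 1 {x}
    rw [ae_iff, ← measureReal_eq_zero_iff]
    simpa using h0
  refine measureReal_congr ?_
  filter_upwards [hae] with ω hω
  have : configAt ω n = configAt ω 0 := by
    funext x
    rw [configAt_eq_true_of_open ω n x (hω x), configAt_eq_true_of_open ω 0 x (hω x)]
  exact congrArg (HasVerticalCrossing δ b h) this

theorem theorem3p1 (F : ℝ → ℝ) (hF : ContinuousOn F (Set.Ioi 0))
    (hlim : ∀ b h : ℝ, 0 < b → 0 < h →
      Tendsto (fun δ : ℝ => crossingProb criticalStar δ b h 0) (𝓝[>] 0) (𝓝 (F (b / h)))) :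
    ∀ n : ℕ∞, ∀ b h : ℝ, 0 < b → 0 < h →
      Tendsto (fun δ : ℝ => crossingProb criticalStar δ b h n) (𝓝[>] 0) (𝓝 (F (b / h))) := by
  intro n b h hb hh
  generalize criticalStar = p at hlim ⊢
  by_cases hp : p = 1
  · subst hp
    simpa only [crossingProb_one _ _ _ n] using hlim b h hb hh
  have hp1 : (p : ℝ) < 1 := lt_of_le_of_ne p.2.2 fun h => hp (Subtype.ext h)
  rw [tendsto_order]
  refine ⟨fun a ha => ?_, fun a ha => ?_⟩
  · filter_upwards [(tendsto_order.1 (hlim b h hb hh)).1 a ha] with δ hδ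
    exact hδ.trans_le (crossingProb_zero_le p δ b h n)
  obtain ⟨s, hs0, hs1, hsF⟩ : ∃ s : ℝ, 0 < s ∧ s < 1 ∧ F (b * (1 + s) / (h * (1 - s))) < a := by
    have hcont : ContinuousAt (fun s : ℝ => F (b * (1 + s) / (h * (1 - s)))) 0 := by
      refine ContinuousAt.comp (g := F) ?_ ?_
      · refine hF.continuousAt (Ioi_mem_nhds ?_)
        simp only [add_zero, sub_zero, mul_one]
        positivity
      · refine ContinuousAt.div (by fun_prop) (by fun_prop) ?_
        simpa using hh.ne'
    have hev : ∀ᶠ s : ℝ in 𝓝 0, F (b * (1 + s) / (h * (1 - s))) < a :=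
      hcont.eventually_lt continuousAt_const (by simpa using ha)
    have hpos : ∃ᶠ s : ℝ in 𝓝 0, 0 < s := frequently_gt_nhds 0
    obtain ⟨s, hs, hsa, hs1⟩ :=
      (hpos.and_eventually (hev.and (eventually_lt_nhds zero_lt_one))).exists
    exact ⟨s, hs, hs1, hsa⟩
  have hb' : b < b * (1 + s) := by nlinarith
  have hh' : 0 < h * (1 - s) := mul_pos hh (by linarith)
  have hh'h : h * (1 - s) < h := by nlinarith
  have hr0 : 0 ≤ 1 - (1 - (p : ℝ)) ^ 4 :=
    sub_nonneg.2 (pow_le_one₀ (by linarith) (by linarith [p.2.1]))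
  have hr1 : 1 - (1 - (p : ℝ)) ^ 4 < 1 := sub_lt_self _ (pow_pos (by linarith) 4)
  have hk : Tendsto (fun δ : ℝ => ⌊(b * (1 + s) - b) / 8 * δ⁻¹⌋₊) (𝓝[>] 0) atTop :=
    tendsto_nat_floor_atTop.comp
      (tendsto_inv_nhdsGT_zero.const_mul_atTop (by linarith))
  have hupper : Tendsto (fun δ : ℝ => crossingProb p δ (b * (1 + s)) (h * (1 - s)) 0 +
      2 * (1 - (1 - (p : ℝ)) ^ 4) ^ ⌊(b * (1 + s) - b) / 8 * δ⁻¹⌋₊) (𝓝[>] 0)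
      (𝓝 (F (b * (1 + s) / (h * (1 - s))))) := by
    simpa using (hlim _ _ (hb.trans hb') hh').add
      (((tendsto_pow_atTop_nhds_zero_of_lt_one hr0 hr1).comp hk).const_mul 2)
  filter_upwards [(tendsto_order.1 hupper).2 a hsF,
    eventually_crossingProb_top_le p hb hb' hh' hh'h] with δ h1 h2
  exact ((crossingProb_le_top p δ b h n).trans h2).trans_lt h1
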